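/- Let $K$ be a field of characteristic zero and let $A$ be a bialgebra over $K$ (associative, unital, coassociative, counital; not necessarily commutative or finite-dimensional) that is cocommutative and connected, i.e. the coradical of $A$ (the sum of all simple subcoalgebras of $A$) is one-dimensional over $K$. Let $P(A)=\{x\in A\mid \Delta(x)=x\otimes 1+1\otimes x\}$ be the space of primitive elements of $A$, which is a Lie algebra under the commutator bracket $[x,y]=xy-yx$, and let $U(P(A))$ be its ordinary universal enveloping algebra, with its usual bialgebra structure, the one for which $\Delta(x)=x\otimes 1+1\otimes x$ and $\varepsilon(x)=0$ for all $x\in P(A)$. Then $A$ is isomorphic to $U(P(A))$ as a bialgebra over $K$. -/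

import Mathlib

open scoped TensorProduct

attribute [local instance 100] LieRing.ofAssociativeRing

section Coradical

variable (K : Type*) {C : Type*} [Field K] [AddCommGroup C] [Module K C] [Coalgebra K C]

/-- A subspace `D` of a coalgebra is a subcoalgebra if `Δ(D) ⊆ D ⊗ D`, where `D ⊗ D` is
viewed inside `C ⊗ C`. -/
def IsSubcoalgebra (D : Submodule K C) : Prop :=
  ∀ x ∈ D, Coalgebra.comul (R := K) x ∈ LinearMap.range (TensorProduct.map D.subtype D.subtype)

/-- A subcoalgebra is simple if it is nonzero and its only subcoalgebras are zero and itself. -/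
structure IsSimpleSubcoalgebra (D : Submodule K C) : Prop where
  isSubcoalgebra : IsSubcoalgebra K D
  ne_bot : D ≠ ⊥
  eq_bot_or_eq : ∀ E : Submodule K C, IsSubcoalgebra K E → E ≤ D → E = ⊥ ∨ E = D

variable (C) in
/-- The coradical: the sum of all simple subcoalgebras. -/
def coradical : Submodule K C :=
  sSup {D : Submodule K C | IsSimpleSubcoalgebra K D}

variable (C) in
/-- A coalgebra is connected if its coradical is one-dimensional. -/
def IsConnectedCoalgebra : Prop :=
  Module.finrank K (coradical K C) = 1

end Coradical

section Primitives

variable (K A : Type*) [Field K] [Ring A] [Bialgebra K A]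

/-- The Lie algebra `P(A)` of primitive elements of a bialgebra, a Lie subalgebra of `A` with the
commutator bracket `⁅x, y⁆ = x * y - y * x`. -/
def primitives : LieSubalgebra K A where
  carrier := {x | Coalgebra.comul (R := K) x = x ⊗ₜ[K] 1 + 1 ⊗ₜ[K] x}
  zero_mem' := by simp
  add_mem' {x y} hx hy := by
    simp only [Set.mem_ofPred_eq] at hx hy ⊢
    rw [map_add, hx, hy, TensorProduct.add_tmul, TensorProduct.tmul_add]
    abel
  smul_mem' r x hx := by
    simp only [Set.mem_ofPred_eq] at hx ⊢
    rw [map_smul, hx, smul_add, TensorProduct.smul_tmul', TensorProduct.tmul_smul]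
  lie_mem' {x y} hx hy := by
    simp only [Set.mem_ofPred_eq] at hx hy ⊢
    change Coalgebra.comul (R := K) (x * y - y * x) =
      (x * y - y * x) ⊗ₜ[K] (1 : A) + (1 : A) ⊗ₜ[K] (x * y - y * x)
    rw [map_sub, Bialgebra.comul_mul, Bialgebra.comul_mul, hx, hy]
    simp only [mul_add, add_mul, Algebra.TensorProduct.tmul_mul_tmul, mul_one, one_mul,
      TensorProduct.sub_tmul, TensorProduct.tmul_sub]
    abel

theorem mem_primitives {x : A} :
    x ∈ primitives K A ↔ Coalgebra.comul (R := K) x = x ⊗ₜ[K] 1 + 1 ⊗ₜ[K] x :=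
  Iff.rfl

theorem coe_lie_primitives (x y : primitives K A) :
    ((⁅x, y⁆ : primitives K A) : A) = (x : A) * (y : A) - (y : A) * (x : A) :=
  rfl

end Primitives

noncomputable section Enveloping

namespace UniversalEnvelopingAlgebra

variable (K L : Type*) [Field K] [LieRing L] [LieAlgebra K L]

variable {K L} in
theorem algHom_ext_ι {B : Type*} [Ring B] [Algebra K B]
    {f g : UniversalEnvelopingAlgebra K L →ₐ[K] B} (h : ∀ x : L, f (ι K x) = g (ι K x)) :
    f = g :=
  hom_ext K (LieHom.ext h)

/-- The Lie algebra map `x ↦ x ⊗ 1 + 1 ⊗ x` from `L` to `U(L) ⊗ U(L)`. -/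
def comulLieHom :
    L →ₗ⁅K⁆ (UniversalEnvelopingAlgebra K L ⊗[K] UniversalEnvelopingAlgebra K L) where
  toFun x := ι K x ⊗ₜ[K] 1 + 1 ⊗ₜ[K] ι K x
  map_add' x y := by
    simp only [map_add, TensorProduct.add_tmul, TensorProduct.tmul_add]
    abel
  map_smul' r x := by
    simp only [map_smul, RingHom.id_apply, smul_add, TensorProduct.smul_tmul',
      TensorProduct.tmul_smul]
  map_lie' {x y} := by
    rw [LieHom.map_lie, LieRing.of_associative_ring_bracket, LieRing.of_associative_ring_bracket]
    simp only [mul_add, add_mul, Algebra.TensorProduct.tmul_mul_tmul, mul_one, one_mul,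
      TensorProduct.sub_tmul, TensorProduct.tmul_sub]
    abel

/-- The bialgebra structure of `U(L)`: the algebra maps `Δ`, `ε` with `Δ(x) = x ⊗ 1 + 1 ⊗ x` and
`ε(x) = 0` for `x` in `L`. -/
instance instBialgebra : Bialgebra K (UniversalEnvelopingAlgebra K L) :=
  .ofAlgHom (lift K (comulLieHom K L)) (lift K (0 : L →ₗ⁅K⁆ K))
    (by
      refine algHom_ext_ι fun x => ?_
      simp [-ι_apply, -lift_ι_apply', lift_ι_apply, comulLieHom, Algebra.TensorProduct.one_def,
        TensorProduct.add_tmul, TensorProduct.tmul_add]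
      abel)
    (by
      refine algHom_ext_ι fun x => ?_
      simp [-ι_apply, -lift_ι_apply', lift_ι_apply, comulLieHom])
    (by
      refine algHom_ext_ι fun x => ?_
      simp [-ι_apply, -lift_ι_apply', lift_ι_apply, comulLieHom])

theorem comul_ι (x : L) :
    Coalgebra.comul (R := K) (ι K x) = ι K x ⊗ₜ[K] 1 + 1 ⊗ₜ[K] ι K x :=
  lift_ι_apply K (comulLieHom K L) x

theorem counit_ι (x : L) : Coalgebra.counit (R := K) (ι K x) = 0 :=
  lift_ι_apply K (0 : L →ₗ⁅K⁆ K) x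

end UniversalEnvelopingAlgebra

end Enveloping

/-! The isomorphism is the inverse of the bialgebra map `U(P(A)) → A` extending the inclusion of the
primitives; the work is to show that map bijective.

Connectedness gives conilpotency (`exists_mem_augmentationFiltration`): each element is killed by
enough successive contractions with functionals vanishing at `1`. So if a linear map `g` kills `1`,
its convolution powers are eventually zero at each element, and convolution power series in `g` make
sense.

Let `e` be the convolution logarithm of the identity (`eulerian`), equivalently the coefficient of
`n` in the `n`th convolution power of `id`. By cocommutativity these powers are coalgebra maps, and
comparing linear coefficients shows that `e` takes primitive values.

Surjectivity: `a - ε(a)` is `e a` minus a combination of higher convolution powers of `augProj`,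
which are generated by primitives by induction on the filtration.

Injectivity: by polarization `U(P(A))` is spanned by the powers `ι x ^ m`. Since `e` fixes
primitives and kills `x ^ m` for `m ≠ 1`, the convolution exponential of `ι ∘ e` sends `x ^ m` to `ι
x ^ m`, hence is a left inverse. -/

/-! ### Detecting tensors by contraction with functionals -/

section TensorFunctionals

variable {K M N : Type*} [Field K] [AddCommGroup M] [Module K M] [AddCommGroup N] [Module K N]

theorem TensorProduct.eq_zero_of_forall_lid_rTensor_eq_zero (t : M ⊗[K] N)
    (h : ∀ f : M →ₗ[K] K, TensorProduct.lid K N (f.rTensor N t) = 0) : t = 0 := by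
  classical
  let b := Module.Basis.ofVectorSpace K M
  apply (TensorProduct.equivFinsuppOfBasisLeft (N := N) b).injective
  rw [map_zero]
  ext i
  rw [TensorProduct.equivFinsuppOfBasisLeft_apply]
  exact h (b.coord i)

theorem TensorProduct.eq_of_forall_lid_rTensor_eq {s t : M ⊗[K] N}
    (h : ∀ f : M →ₗ[K] K,
      TensorProduct.lid K N (f.rTensor N s) = TensorProduct.lid K N (f.rTensor N t)) : s = t :=
  sub_eq_zero.1 <| TensorProduct.eq_zero_of_forall_lid_rTensor_eq_zero _ fun f => by
    rw [map_sub, map_sub, h, sub_self]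

theorem TensorProduct.lid_rTensor_lTensor {P : Type*} [AddCommGroup P] [Module K P]
    (f : M →ₗ[K] K) (q : N →ₗ[K] P) (t : M ⊗[K] N) :
    TensorProduct.lid K P (f.rTensor P (q.lTensor M t)) =
      q (TensorProduct.lid K N (f.rTensor N t)) := by
  induction t with
  | zero => simp
  | tmul x y => simp
  | add x y hx hy => simp only [map_add, hx, hy]

/-- If the left contractions of `t` by functionals vanishing at `u` are killed by `q`, and `p`
vanishes at `u`, then `p ⊗ q` kills `t`. -/
theorem TensorProduct.map_eq_zero_of_forall_contract {P Q : Type*} [AddCommGroup P] [Module K P]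
    [AddCommGroup Q] [Module K Q] (t : M ⊗[K] N) (u : M) (p : M →ₗ[K] P) (q : N →ₗ[K] Q)
    (hp : p u = 0)
    (h : ∀ f : M →ₗ[K] K, f u = 0 → q (TensorProduct.lid K N (f.rTensor N t)) = 0) :
    TensorProduct.map p q t = 0 := by
  apply TensorProduct.eq_zero_of_forall_lid_rTensor_eq_zero
  intro f
  rw [← h (f ∘ₗ p) (by simp [hp])]
  clear h
  induction t with
  | zero => simp
  | tmul x y => simp
  | add x y hx hy => simp only [map_add, hx, hy]

end TensorFunctionals

/-! ### A cocommutative coalgebra as a module over its dual algebra -/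

section DualAction

variable (K : Type*) {C : Type*} [Field K] [AddCommGroup C] [Module K C] [Coalgebra K C]

/-- Left contraction `a ↦ ∑ f(a₁) a₂` of the comultiplication by a functional. -/
noncomputable def leftContract : (C →ₗ[K] K) →ₗ[K] C →ₗ[K] C where
  toFun f := (TensorProduct.lid K C).toLinearMap ∘ₗ f.rTensor C ∘ₗ Coalgebra.comul
  map_add' f g := by ext; simp [LinearMap.rTensor_add]
  map_smul' r f := by ext; simp [LinearMap.rTensor_smul]

variable {K}

theorem leftContract_apply (f : C →ₗ[K] K) (a : C) :
    leftContract K f a = TensorProduct.lid K C (f.rTensor C (Coalgebra.comul a)) := rfl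

theorem leftContract_repr {ι : Type*} {a : C} (r : Coalgebra.Repr K a ι) (f : C →ₗ[K] K) :
    leftContract K f a = ∑ i ∈ r.index, f (r.left i) • r.right i := by
  simp [leftContract_apply, ← r.eq]

theorem leftContract_counit (a : C) : leftContract K Coalgebra.counit a = a := by
  simp [leftContract_apply, Coalgebra.rTensor_counit_comul]

/-- This is coassociativity. The order of the factors reverses, so a left action needs convolution
to be commutative. -/
theorem leftContract_leftContract (f g : C →ₗ[K] K) (a : C) :
    leftContract K f (leftContract K g a) =
      leftContract K (WithConv.toConv g * WithConv.toConv f).ofConv a := by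
  let T : C ⊗[K] (C ⊗[K] C) →ₗ[K] C := (TensorProduct.lid K C).toLinearMap ∘ₗ
    TensorProduct.map g ((TensorProduct.lid K C).toLinearMap ∘ₗ f.rTensor C)
  have h1 (t : C ⊗[K] C) : leftContract K f (TensorProduct.lid K C (g.rTensor C t)) =
      T ((Coalgebra.comul (R := K)).lTensor C t) := by
    induction t with
    | zero => simp
    | tmul x y => simp [T, leftContract_apply]
    | add x y hx hy => simp only [map_add, hx, hy]
  have h3 (z : C) (t : C ⊗[K] C) :
      LinearMap.mul' K K (TensorProduct.map g f t) • z =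
        T (TensorProduct.assoc K C C C (t ⊗ₜ[K] z)) := by
    induction t with
    | zero => simp
    | tmul x y => simp [T, mul_smul, smul_comm (g x)]
    | add x y hx hy => simp only [map_add, TensorProduct.add_tmul, add_smul, hx, hy]
  have h2 (t : C ⊗[K] C) : TensorProduct.lid K C
      ((WithConv.toConv g * WithConv.toConv f).ofConv.rTensor C t) =
      T (TensorProduct.assoc K C C C ((Coalgebra.comul (R := K)).rTensor C t)) := by
    induction t with
    | zero => simp
    | tmul x y => simp [← h3]
    | add x y hx hy => simp only [map_add, hx, hy]
  rw [leftContract_apply g, leftContract_apply _ a, h1, h2, Coalgebra.coassoc_apply]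

variable (K C) in
/-- The convolution algebra of functionals on a cocommutative coalgebra. -/
def DualAlgebra : Type _ := WithConv (C →ₗ[K] K)

namespace DualAlgebra

variable [Coalgebra.IsCocomm K C]

noncomputable instance : CommRing (DualAlgebra K C) :=
  inferInstanceAs (CommRing (WithConv (C →ₗ[K] K)))

noncomputable instance : Module K (DualAlgebra K C) :=
  inferInstanceAs (Module K (WithConv (C →ₗ[K] K)))

/-- A functional as an element of the dual algebra. -/
def of (f : C →ₗ[K] K) : DualAlgebra K C := WithConv.toConv f

/-- The functional underlying an element of the dual algebra. -/
def toLinearMap (f : DualAlgebra K C) : C →ₗ[K] K := WithConv.ofConv f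

/-- The action of the dual algebra on a cocommutative coalgebra by contraction. -/
noncomputable instance : Module (DualAlgebra K C) C where
  smul f a := leftContract K f.toLinearMap a
  one_smul a := leftContract_counit a
  mul_smul f g a := by
    rw [mul_comm]
    exact (leftContract_leftContract f.toLinearMap g.toLinearMap a).symm
  smul_zero f := map_zero _
  smul_add f := map_add _
  add_smul f g a :=
    LinearMap.congr_fun (map_add (leftContract K) f.toLinearMap g.toLinearMap) a
  zero_smul a := LinearMap.congr_fun (map_zero (leftContract K)) a

theorem smul_def (f : DualAlgebra K C) (a : C) : f • a = leftContract K f.toLinearMap a := rfl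

instance : IsScalarTower K (DualAlgebra K C) C where
  smul_assoc r f a := LinearMap.congr_fun (map_smul (leftContract K) r f.toLinearMap) a

theorem smul_of_isGroupLikeElem {u : C} (hu : IsGroupLikeElem K u) (f : DualAlgebra K C) :
    f • u = f.toLinearMap u • u := by
  rw [smul_def, leftContract_apply, hu.comul_eq_tmul_self]
  simp

/-- The ideal of functionals vanishing at a group-like element. -/
noncomputable def vanishingIdeal {u : C} (hu : IsGroupLikeElem K u) : Ideal (DualAlgebra K C) where
  carrier := {f | f.toLinearMap u = 0}
  zero_mem' := rfl
  add_mem' {f g} hf hg := by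
    change f.toLinearMap u + g.toLinearMap u = 0
    rw [hf, hg, add_zero]
  smul_mem' f g hg := by
    change LinearMap.mul' K K (TensorProduct.map f.toLinearMap g.toLinearMap
      (Coalgebra.comul (R := K) u)) = 0
    rw [hu.comul_eq_tmul_self]
    simp [show g.toLinearMap u = 0 from hg]

end DualAlgebra

theorem leftContract_mem {D : Submodule K C} (hD : IsSubcoalgebra K D) (f : C →ₗ[K] K) {a : C}
    (ha : a ∈ D) : leftContract K f a ∈ D := by
  obtain ⟨t, ht⟩ := hD a ha
  rw [leftContract_apply, ← ht]
  clear ht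
  induction t with
  | zero => simp
  | tmul x y => simpa using D.smul_mem _ y.2
  | add x y hx hy => simpa only [map_add] using D.add_mem hx hy

/-- Stability under contraction places the right leg of `Δ a` in `D`; cocommutativity does the same
for the left leg. A linear projection onto `D` then fixes `Δ a` in both legs. -/
theorem isSubcoalgebra_of_leftContract_mem [Coalgebra.IsCocomm K C] {D : Submodule K C}
    (h : ∀ f : C →ₗ[K] K, ∀ a ∈ D, leftContract K f a ∈ D) : IsSubcoalgebra K D := by
  intro a ha
  obtain ⟨p, hp⟩ := D.subtype.exists_leftInverse_of_injective (by simp)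
  set q : C →ₗ[K] C := D.subtype ∘ₗ p
  have hq : ∀ x ∈ D, q x = x := fun x hx =>
    congrArg Subtype.val (LinearMap.congr_fun hp ⟨x, hx⟩)
  have h1 : q.lTensor C (Coalgebra.comul (R := K) a) = Coalgebra.comul (R := K) a := by
    apply TensorProduct.eq_of_forall_lid_rTensor_eq
    intro f
    rw [TensorProduct.lid_rTensor_lTensor]
    exact hq _ (h f a ha)
  have h2 : q.rTensor C (Coalgebra.comul (R := K) a) = Coalgebra.comul (R := K) a := by
    have := congrArg (TensorProduct.comm K C C) h1
    rwa [Coalgebra.comm_comul, LinearMap.lTensor, ← TensorProduct.map_comm,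
      Coalgebra.comm_comul] at this
  refine ⟨TensorProduct.map p p (Coalgebra.comul (R := K) a), ?_⟩
  rw [← LinearMap.comp_apply, ← TensorProduct.map_comp, ← LinearMap.rTensor_comp_lTensor,
    LinearMap.comp_apply]
  exact (congrArg _ h1).trans h2

theorem finiteDimensional_range_leftContract (a : C) :
    ∃ D : Submodule K C, FiniteDimensional K D ∧ ∀ f, leftContract K f a ∈ D := by
  classical
  let r := Coalgebra.Repr.arbitrary K a
  refine ⟨Submodule.span K (r.index.image r.right : Finset C), inferInstance, fun f => ?_⟩
  rw [leftContract_repr r]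
  refine Submodule.sum_mem _ fun i hi => Submodule.smul_mem _ _ (Submodule.subset_span ?_)
  exact Finset.mem_coe.2 (Finset.mem_image_of_mem _ hi)

end DualAction

/-! ### Conilpotency from the coradical -/

section Conilpotent

variable {K C : Type*} [Field K] [AddCommGroup C] [Module K C] [Coalgebra K C]

/-- The filtration of a coalgebra by the elements killed by `n` successive contractions with
functionals vanishing at `u`. -/
noncomputable def augmentationFiltration (K : Type*) {C : Type*} [Field K] [AddCommGroup C]
    [Module K C] [Coalgebra K C] (u : C) : ℕ → Submodule K C
  | 0 => ⊥
  | n + 1 => ⨅ (f : C →ₗ[K] K) (_ : f u = 0),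
      (augmentationFiltration K u n).comap (leftContract K f)

theorem mem_augmentationFiltration_succ {u : C} {n : ℕ} {a : C} :
    a ∈ augmentationFiltration K u (n + 1) ↔
      ∀ f : C →ₗ[K] K, f u = 0 → leftContract K f a ∈ augmentationFiltration K u n := by
  simp [augmentationFiltration]

/-- As `g` kills `u`, one factor `g` only sees contractions by functionals vanishing at `u`, and
these lower the filtration degree. -/
theorem convPow_eq_zero_of_mem_augmentationFiltration {B : Type*} [Ring B] [Algebra K B] {u : C}
    {n : ℕ} {a : C} (ha : a ∈ augmentationFiltration K u n) (g : C →ₗ[K] B) (hg : g u = 0)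
    {k : ℕ} (hk : n ≤ k) : (WithConv.toConv g ^ k) a = 0 := by
  induction n generalizing a k with
  | zero =>
    obtain rfl : a = 0 := ha
    exact map_zero _
  | succ n ih =>
    obtain ⟨k, rfl⟩ := Nat.exists_eq_add_of_le' (Nat.one_le_of_lt hk)
    rw [mem_augmentationFiltration_succ] at ha
    rw [pow_succ', LinearMap.convMul_apply, TensorProduct.map_eq_zero_of_forall_contract _ u _ _ hg,
      map_zero]
    exact fun f hf => ih (ha f hf) (by omega)

/-- This drives the induction for generation: a product of two maps killing `u` only involves their
values one filtration step lower. -/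
theorem convMul_mem_of_mem_augmentationFiltration_succ [Coalgebra.IsCocomm K C] {B : Type*} [Ring B]
    [Algebra K B] {u : C} {n : ℕ} {a : C} (ha : a ∈ augmentationFiltration K u (n + 1))
    (p q : C →ₗ[K] B) (hp : p u = 0) (hq : q u = 0) (S : Subalgebra K B)
    (hpS : ∀ b ∈ augmentationFiltration K u n, p b ∈ S)
    (hqS : ∀ b ∈ augmentationFiltration K u n, q b ∈ S) :
    (WithConv.toConv p * WithConv.toConv q) a ∈ S := by
  rw [mem_augmentationFiltration_succ] at ha
  obtain ⟨r, hr⟩ := (Subalgebra.toSubmodule S).subtype.exists_leftInverse_of_injective (by simp)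
  set s : B →ₗ[K] B := (Subalgebra.toSubmodule S).subtype ∘ₗ r
  have hs : ∀ x ∈ S, s x = x := fun x hx => congrArg Subtype.val (LinearMap.congr_fun hr ⟨x, hx⟩)
  have key (p q : C →ₗ[K] B) (hp : p u = 0)
      (hqS : ∀ b ∈ augmentationFiltration K u n, q b ∈ S) :
      TensorProduct.map p q (Coalgebra.comul (R := K) a) =
        TensorProduct.map p (s ∘ₗ q) (Coalgebra.comul (R := K) a) := by
    have h0 : TensorProduct.map p q = TensorProduct.map p (s ∘ₗ q) +
        TensorProduct.map p (q - s ∘ₗ q) := by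
      rw [← TensorProduct.map_add_right, add_sub_cancel]
    rw [h0, LinearMap.add_apply, add_eq_left]
    refine TensorProduct.map_eq_zero_of_forall_contract _ u _ _ hp fun f hf => ?_
    rw [LinearMap.sub_apply, LinearMap.comp_apply, sub_eq_zero]
    exact (hs _ (hqS _ (ha f hf))).symm
  have h1 : TensorProduct.map p q (Coalgebra.comul (R := K) a) =
      TensorProduct.map (s ∘ₗ p) (s ∘ₗ q) (Coalgebra.comul (R := K) a) := by
    rw [key p q hp hqS]
    -- Cocommutativity lets `key` be applied to the other leg.
    apply (TensorProduct.comm K B B).injective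
    rw [← TensorProduct.map_comm, ← TensorProduct.map_comm, Coalgebra.comm_comul]
    exact key (s ∘ₗ q) p (by simp [hq]) hpS
  rw [LinearMap.convMul_apply]
  change LinearMap.mul' K B (TensorProduct.map p q (Coalgebra.comul (R := K) a)) ∈ S
  rw [h1]
  generalize Coalgebra.comul (R := K) a = t
  induction t with
  | zero => simp
  | tmul x y => exact S.mul_mem (r (p x)).2 (r (q y)).2
  | add x y hx hy => simpa only [map_add] using S.add_mem hx hy

section

variable [Coalgebra.IsCocomm K C]

open DualAlgebra

theorem mem_augmentationFiltration_of_pow_smul {u : C} (hu : IsGroupLikeElem K u) {n : ℕ} {a : C}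
    (h : ∀ r ∈ vanishingIdeal hu ^ n, r • a = 0) : a ∈ augmentationFiltration K u n := by
  induction n generalizing a with
  | zero =>
    rw [← one_smul (DualAlgebra K C) a, h 1 (by simp)]
    exact zero_mem _
  | succ n ih =>
    rw [mem_augmentationFiltration_succ]
    intro f hf
    refine ih fun r hr => ?_
    change r • (of f • a) = 0
    rw [← mul_smul]
    exact h _ (by rw [pow_succ]; exact Ideal.mul_mem_mul hr hf)

/-- The cyclic module `M` generated by `a` is finite-dimensional, so `J ^ n M` stabilises at some `N
= J N`. By Nakayama some `r ≡ 1` modulo `J` kills `N`. If `N` were nonzero it would contain a simple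
submodule, which is a simple subcoalgebra and so lies in the line of `u`; but `r` acts there as the
identity. -/
theorem exists_mem_augmentationFiltration {u : C} (hu : IsGroupLikeElem K u)
    (h : ∀ D : Submodule K C, IsSimpleSubcoalgebra K D → D ≤ Submodule.span K {u}) (a : C) :
    ∃ n, a ∈ augmentationFiltration K u n := by
  let R := DualAlgebra K C
  let M := Submodule.span R {a}
  have hfin : Module.Finite K M := by
    obtain ⟨D, hD, hDa⟩ := finiteDimensional_range_leftContract (K := K) a
    have hle : M.restrictScalars K ≤ D := by
      intro x hx
      obtain ⟨f, rfl⟩ := Submodule.mem_span_singleton.1 hx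
      exact hDa _
    exact Submodule.finiteDimensional_of_le hle
  have hart : IsArtinian R M := isArtinian_of_tower K (inferInstanceAs (IsArtinian K M))
  have hnoe : IsNoetherian R M := isNoetherian_of_tower K (inferInstanceAs (IsNoetherian K M))
  set J := vanishingIdeal hu
  let F : ℕ →o (Submodule R M)ᵒᵈ :=
    ⟨fun n => OrderDual.toDual (J ^ n • (⊤ : Submodule R M)), fun _ _ hmn =>
      Submodule.smul_mono_left (Ideal.pow_le_pow_right hmn)⟩
  obtain ⟨n, hn⟩ := IsArtinian.monotone_stabilizes F
  set N : Submodule R M := J ^ n • ⊤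
  have hN : N ≤ J • N := by
    have : N = J ^ (n + 1) • ⊤ := congrArg OrderDual.ofDual (hn (n + 1) n.le_succ)
    rw [pow_succ', Submodule.mul_smul] at this
    exact this.le
  obtain ⟨r, hr1, hr⟩ := Submodule.exists_sub_one_mem_and_smul_eq_zero_of_fg_of_le_smul J N
    (IsNoetherian.noetherian N) hN
  have hbot : N = ⊥ := by
    by_contra hne
    obtain ⟨S, hS, hSN⟩ := (eq_bot_or_exists_atom_le N).resolve_left hne
    have hsimple : IsSimpleSubcoalgebra K ((S.map M.subtype).restrictScalars K) := by
      refine ⟨isSubcoalgebra_of_leftContract_mem fun f x hx =>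
        (S.map M.subtype).smul_mem (of f) hx, ?_, ?_⟩
      · obtain ⟨x, hx, hx0⟩ := S.ne_bot_iff.1 hS.1
        exact (Submodule.ne_bot_iff _).2
          ⟨x, Submodule.mem_map_of_mem hx, fun h0 => hx0 (Subtype.ext h0)⟩
      · intro E hE hES
        -- A subcoalgebra is stable under contraction, so simplicity of `S` as a module applies to
        -- it.
        let E' : Submodule R C := { E with smul_mem' := fun f x hx => leftContract_mem hE _ hx }
        have hE' : E'.comap M.subtype ≤ S := by
          intro x hx
          obtain ⟨y, hy, hyx⟩ := hES hx
          rwa [← Subtype.ext hyx]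
        have hmap : ∀ x ∈ E, ∃ y : M, y ∈ E'.comap M.subtype ∧ (y : C) = x := fun x hx => by
          obtain ⟨y, -, hyx⟩ := hES hx
          exact ⟨y, by rwa [← hyx] at hx, hyx⟩
        rcases hS.le_iff.1 hE' with h0 | h1
        · refine Or.inl ((Submodule.eq_bot_iff _).2 fun x hx => ?_)
          obtain ⟨y, hy, rfl⟩ := hmap x hx
          rw [h0, Submodule.mem_bot] at hy
          rw [hy, Submodule.coe_zero]
        · refine Or.inr (le_antisymm hES ?_)
          rintro _ ⟨y, hy, rfl⟩
          rw [SetLike.mem_coe, ← h1] at hy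
          exact hy
    obtain ⟨s, hs, hs0⟩ := S.ne_bot_iff.1 hS.1
    obtain ⟨c, hc⟩ := Submodule.mem_span_singleton.1 (h _ hsimple (Submodule.mem_map_of_mem hs))
    have hru : r • u = u := by
      have h1 : (r - 1) • u = 0 := by
        rw [smul_of_isGroupLikeElem hu, show (r - 1).toLinearMap u = 0 from hr1, zero_smul]
      rwa [sub_smul, one_smul, sub_eq_zero] at h1
    apply hs0
    have h0 : r • (s : C) = 0 := congrArg Subtype.val (hr s (hSN hs))
    apply Subtype.ext
    change c • u = (s : C) at hc
    rw [← hc, smul_def, map_smul, ← smul_def, hru, hc] at h0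
    exact h0
  refine ⟨n, mem_augmentationFiltration_of_pow_smul hu fun r hr => ?_⟩
  have : r • (⟨a, Submodule.mem_span_singleton_self a⟩ : M) ∈ N :=
    Submodule.smul_mem_smul hr trivial
  rw [hbot, Submodule.mem_bot] at this
  exact congrArg Subtype.val this

end

end Conilpotent

/-! ### Connected bialgebras -/

section Connected

variable {K A : Type*} [Field K] [Ring A] [Bialgebra K A]

theorem isSimpleSubcoalgebra_span_one : IsSimpleSubcoalgebra K (Submodule.span K {(1 : A)}) := by
  have : Nontrivial A := (Bialgebra.counitAlgHom K A).toRingHom.domain_nontrivial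
  refine ⟨?_, by simp, ?_⟩
  · intro x hx
    obtain ⟨c, rfl⟩ := Submodule.mem_span_singleton.1 hx
    let e : Submodule.span K {(1 : A)} := ⟨1, Submodule.mem_span_singleton_self 1⟩
    refine ⟨c • (e ⊗ₜ e), ?_⟩
    simp [e, Algebra.TensorProduct.one_def]
  · intro E _ hE
    exact (nonzero_span_atom (K := K) (1 : A) one_ne_zero).le_iff.1 hE

theorem coradical_eq_span_one (hA : IsConnectedCoalgebra K A) :
    coradical K A = Submodule.span K {(1 : A)} := by
  have : Nontrivial A := (Bialgebra.counitAlgHom K A).toRingHom.domain_nontrivial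
  have : FiniteDimensional K (coradical K A) := Module.finite_of_finrank_eq_succ hA
  refine (Submodule.eq_of_le_of_finrank_eq (S₂ := coradical K A)
    (le_sSup isSimpleSubcoalgebra_span_one) ?_).symm
  rw [finrank_span_singleton one_ne_zero]
  exact hA.symm

theorem IsConnectedCoalgebra.exists_mem_augmentationFiltration [Coalgebra.IsCocomm K A]
    (hA : IsConnectedCoalgebra K A) (a : A) : ∃ n, a ∈ augmentationFiltration K (1 : A) n :=
  _root_.exists_mem_augmentationFiltration IsGroupLikeElem.one
    (fun _ hD => coradical_eq_span_one hA ▸ le_sSup hD) a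

end Connected

/-! ### Linear coefficients of polynomial sequences -/

section LinearCoefficient

open Polynomial

variable {K V W : Type*} [Field K] [AddCommGroup V] [Module K V] [AddCommGroup W] [Module K W]

/-- After composition with any functional, `u` becomes a polynomial function on `ℕ` whose
coefficient of degree one is the value of the functional at `v`. -/
def HasLinearCoeff (K : Type*) {V : Type*} [Field K] [AddCommGroup V] [Module K V] (u : ℕ → V)
    (v : V) : Prop :=
  ∀ φ : V →ₗ[K] K, ∃ p : K[X], (∀ n : ℕ, φ (u n) = p.eval (n : K)) ∧ φ v = p.coeff 1

namespace HasLinearCoeff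

theorem map {u : ℕ → V} {v : V} (h : HasLinearCoeff K u v) (T : V →ₗ[K] W) :
    HasLinearCoeff K (fun n => T (u n)) (T v) :=
  fun φ => h (φ ∘ₗ T)

theorem zero : HasLinearCoeff K (fun _ => (0 : V)) 0 := fun φ => ⟨0, by simp⟩

theorem add {u u' : ℕ → V} {v v' : V} (h : HasLinearCoeff K u v) (h' : HasLinearCoeff K u' v') :
    HasLinearCoeff K (fun n => u n + u' n) (v + v') := by
  intro φ
  obtain ⟨p, hp, hp1⟩ := h φ
  obtain ⟨q, hq, hq1⟩ := h' φ
  exact ⟨p + q, fun n => by simp [hp, hq], by simp [hp1, hq1]⟩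

theorem sum {ι : Type*} (s : Finset ι) {u : ι → ℕ → V} {v : ι → V}
    (h : ∀ i ∈ s, HasLinearCoeff K (u i) (v i)) :
    HasLinearCoeff K (fun n => ∑ i ∈ s, u i n) (∑ i ∈ s, v i) := by
  classical
  induction s using Finset.induction_on with
  | empty => simpa using zero
  | insert i s hi ih =>
    simp only [Finset.sum_insert hi]
    exact (h i (Finset.mem_insert_self i s)).add
      (ih fun j hj => h j (Finset.mem_insert_of_mem hj))

theorem eval_smul (p : K[X]) (c : V) :
    HasLinearCoeff K (fun n => p.eval (n : K) • c) (p.coeff 1 • c) :=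
  fun φ => ⟨C (φ c) * p, fun n => by simp [mul_comm], by simp [mul_comm]⟩

/-- A functional vanishing on `S` but not at `v` would give a polynomial with all natural numbers as
roots, hence zero in characteristic zero. -/
theorem mem [CharZero K] {u : ℕ → V} {v : V} (h : HasLinearCoeff K u v) (S : Submodule K V)
    (hS : ∀ n, u n ∈ S) : v ∈ S := by
  by_contra hv
  obtain ⟨φ, hφ, hle⟩ := S.exists_le_ker_of_notMem hv
  obtain ⟨p, hp, hp1⟩ := h φ
  have : p = 0 := by
    refine p.eq_zero_of_infinite_isRoot
      (Set.Infinite.mono ?_ (Set.infinite_range_of_injective (Nat.cast_injective (R := K))))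
    rintro _ ⟨n, rfl⟩
    exact (hp n).symm.trans (hle (hS n))
  exact hφ (by simp [hp1, this])

theorem unique [CharZero K] {u : ℕ → V} {v v' : V} (h : HasLinearCoeff K u v)
    (h' : HasLinearCoeff K u v') : v = v' := by
  have h0 := h.add (h'.map (-LinearMap.id))
  rw [← sub_eq_zero]
  simpa [sub_eq_add_neg] using h0.mem ⊥ (by simp)

end HasLinearCoeff

variable (K) in
/-- The polynomial whose value at a natural number `n` is the binomial coefficient `n.choose k`. -/
noncomputable def binomialPoly (k : ℕ) : K[X] := C ((k.factorial : K)⁻¹) * descPochhammer K k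

theorem binomialPoly_eval [CharZero K] (k n : ℕ) :
    (binomialPoly K k).eval (n : K) = n.choose k := by
  rw [binomialPoly, eval_mul, eval_C, descPochhammer_eval_eq_descFactorial,
    Nat.descFactorial_eq_factorial_mul_choose, Nat.cast_mul,
    inv_mul_cancel_left₀ (Nat.cast_ne_zero.2 k.factorial_ne_zero)]

theorem binomialPoly_zero : binomialPoly K 0 = 1 := by simp [binomialPoly]

theorem binomialPoly_one : binomialPoly K 1 = X := by simp [binomialPoly]

theorem binomialPoly_coeff_zero [CharZero K] (k : ℕ) :
    (binomialPoly K k).coeff 0 = if k = 0 then 1 else 0 := by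
  rw [coeff_zero_eq_eval_zero, ← Nat.cast_zero, binomialPoly_eval]
  cases k <;> simp

end LinearCoefficient

/-! ### Pointwise finite sums of linear maps -/

section LocallyFiniteSum

variable {K V W : Type*} [Field K] [AddCommGroup V] [Module K V] [AddCommGroup W] [Module K W]

theorem hasFiniteSupport_of_eventually_zero {u : ℕ → W} {N : ℕ} (h : ∀ k, N ≤ k → u k = 0) :
    u.HasFiniteSupport :=
  (Set.finite_lt_nat N).subset fun k hk => by
    by_contra hlt
    exact hk (h k (not_lt.1 hlt))

/-- The pointwise sum of a sequence of linear maps that is eventually zero at each point. -/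
noncomputable def locallyFiniteSum (T : ℕ → V →ₗ[K] W) (h : ∀ a, ∃ N, ∀ k, N ≤ k → T k a = 0) :
    V →ₗ[K] W where
  toFun a := ∑ᶠ k, T k a
  map_add' a b := by
    obtain ⟨N, hN⟩ := h a
    obtain ⟨M, hM⟩ := h b
    simp only [map_add]
    exact finsum_add_distrib (hasFiniteSupport_of_eventually_zero hN)
      (hasFiniteSupport_of_eventually_zero hM)
  map_smul' r a := by
    simp only [map_smul, RingHom.id_apply, smul_finsum]

theorem locallyFiniteSum_apply (T : ℕ → V →ₗ[K] W) (h : ∀ a, ∃ N, ∀ k, N ≤ k → T k a = 0) {a : V}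
    {N : ℕ} (hN : ∀ k, N ≤ k → T k a = 0) :
    locallyFiniteSum T h a = ∑ k ∈ Finset.range N, T k a := by
  refine finsum_eq_sum_of_support_subset _ fun k hk => ?_
  rw [Finset.coe_range]
  by_contra hlt
  exact hk (hN k (not_lt.1 hlt))

end LocallyFiniteSum

/-! ### The first Eulerian idempotent and generation by primitives -/

section Eulerian

open WithConv

variable {K A : Type*} [Field K] [Ring A] [Bialgebra K A]

variable (K A) in
/-- The projection of a bialgebra to its augmentation ideal. -/
noncomputable def augProj : A →ₗ[K] A :=
  LinearMap.id - Algebra.linearMap K A ∘ₗ Coalgebra.counit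

theorem augProj_one : augProj K A 1 = 0 := by simp [augProj]

theorem toConv_id_eq : toConv (LinearMap.id : A →ₗ[K] A) = toConv (augProj K A) + 1 := by
  rw [augProj, toConv_sub, LinearMap.convOne_def, sub_add_cancel]

theorem convPow_succ_apply_one {B : Type*} [Ring B] [Algebra K B] (g : A →ₗ[K] B) (hg : g 1 = 0)
    (k : ℕ) : (toConv g ^ (k + 1)) (1 : A) = 0 := by
  rw [pow_succ, LinearMap.convMul_apply, Bialgebra.comul_one, Algebra.TensorProduct.one_def]
  simp [hg]

/-- Binomial theorem for `id = augProj + 1`. The range `N` does not depend on `n`, so the right side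
is polynomial in `n`. -/
theorem convPow_id_apply (n N : ℕ) {a : A}
    (hN : ∀ k, N ≤ k → (toConv (augProj K A) ^ k) a = 0) :
    (toConv (LinearMap.id : A →ₗ[K] A) ^ n) a =
      ∑ k ∈ Finset.range N, (n.choose k : K) • (toConv (augProj K A) ^ k) a := by
  have h1 : (toConv (LinearMap.id : A →ₗ[K] A) ^ n) a =
      ∑ k ∈ Finset.range (n + 1), (n.choose k : K) • (toConv (augProj K A) ^ k) a := by
    rw [toConv_id_eq, (Commute.one_right _).add_pow]
    simp only [one_pow, mul_one, ofConv_sum, LinearMap.sum_apply]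
    refine Finset.sum_congr rfl fun k _ => ?_
    rw [← nsmul_eq_mul', Nat.cast_smul_eq_nsmul]
    rfl
  rw [h1]
  trans ∑ k ∈ Finset.range (max (n + 1) N), (n.choose k : K) • (toConv (augProj K A) ^ k) a
  · refine Finset.sum_subset (Finset.range_mono (le_max_left _ _)) fun k _ hk => ?_
    rw [Nat.choose_eq_zero_of_lt (by simpa using hk), Nat.cast_zero, zero_smul]
  · refine (Finset.sum_subset (Finset.range_mono (le_max_right _ _)) fun k _ hk => ?_).symm
    rw [hN k (by simpa using hk), smul_zero]

/-- Multiplication is always a coalgebra map, and comultiplication is one by cocommutativity. -/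
theorem exists_coalgHom_eq_convPow_id [Coalgebra.IsCocomm K A] (n : ℕ) :
    ∃ h : A →ₗc[K] A, h.toLinearMap = (toConv (LinearMap.id : A →ₗ[K] A) ^ n).ofConv := by
  induction n with
  | zero =>
    exact ⟨((Bialgebra.unitBialgHom K A).comp (Bialgebra.counitBialgHom K A)).toCoalgHom, rfl⟩
  | succ n ih =>
    obtain ⟨h, hh⟩ := ih
    refine ⟨(Bialgebra.mulCoalgHom K A).comp
      ((Coalgebra.TensorProduct.map h (CoalgHom.id K A)).comp (Coalgebra.comulCoalgHom K A)), ?_⟩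
    rw [pow_succ, LinearMap.convMul_def, ← hh]
    rfl

theorem comul_convPow_id [Coalgebra.IsCocomm K A] (n : ℕ) (a : A) :
    Coalgebra.comul (R := K) ((toConv (LinearMap.id : A →ₗ[K] A) ^ n) a) =
      TensorProduct.map (toConv (LinearMap.id : A →ₗ[K] A) ^ n).ofConv
        (toConv (LinearMap.id : A →ₗ[K] A) ^ n).ofConv (Coalgebra.comul (R := K) a) := by
  obtain ⟨h, hh⟩ := exists_coalgHom_eq_convPow_id (K := K) (A := A) n
  rw [← hh]
  exact (LinearMap.congr_fun h.map_comp_comul a).symm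

section Conilpotent

theorem exists_convPow_eq_zero (hA : ∀ a : A, ∃ n, a ∈ augmentationFiltration K (1 : A) n)
    {B : Type*} [Ring B] [Algebra K B] (g : A →ₗ[K] B) (hg : g 1 = 0) (a : A) : ∃ N, ∀ k, N ≤ k → (toConv g ^ k) a = 0 :=
  (hA a).imp fun _ hn _ hk => convPow_eq_zero_of_mem_augmentationFiltration hn g hg hk

variable (hA : ∀ a : A, ∃ n, a ∈ augmentationFiltration K (1 : A) n)

/-- The first Eulerian idempotent: the coefficient of `n` in the `n`th convolution power of the
identity, that is, the convolution logarithm of the identity. -/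
noncomputable def eulerian : A →ₗ[K] A :=
  locallyFiniteSum (fun k => (binomialPoly K k).coeff 1 • (toConv (augProj K A) ^ k).ofConv)
    fun a => (exists_convPow_eq_zero hA (augProj K A) augProj_one a).imp fun N hN k hk => by
      rw [LinearMap.smul_apply, hN k hk, smul_zero]

theorem eulerian_apply {a : A} {N : ℕ} (hN : ∀ k, N ≤ k → (toConv (augProj K A) ^ k) a = 0) :
    eulerian hA a = ∑ k ∈ Finset.range N,
      (binomialPoly K k).coeff 1 • (toConv (augProj K A) ^ k) a :=
  locallyFiniteSum_apply _ _ fun k hk => by rw [LinearMap.smul_apply, hN k hk, smul_zero]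

theorem hasLinearCoeff_eulerian [CharZero K] (a : A) :
    HasLinearCoeff K (fun n => (toConv (LinearMap.id : A →ₗ[K] A) ^ n) a) (eulerian hA a) := by
  obtain ⟨N, hN⟩ := exists_convPow_eq_zero hA (augProj K A) augProj_one a
  simp only [eulerian_apply hA hN, convPow_id_apply _ N hN, ← binomialPoly_eval]
  exact HasLinearCoeff.sum _ fun k _ => HasLinearCoeff.eval_smul _ _

/-- Leibniz rule: the constant coefficient of the `n`th convolution power is the convolution unit,
the linear one is `eulerian`. -/
theorem hasLinearCoeff_tmul_convPow [CharZero K] (x y : A) :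
    HasLinearCoeff K (fun n => (toConv (LinearMap.id : A →ₗ[K] A) ^ n) x ⊗ₜ[K]
        (toConv (LinearMap.id : A →ₗ[K] A) ^ n) y)
      (eulerian hA x ⊗ₜ[K] algebraMap K A (Coalgebra.counit y) +
        algebraMap K A (Coalgebra.counit x) ⊗ₜ[K] eulerian hA y) := by
  obtain ⟨N, hN⟩ := exists_convPow_eq_zero hA (augProj K A) augProj_one x
  obtain ⟨M, hM⟩ := exists_convPow_eq_zero hA (augProj K A) augProj_one y
  -- The bound is raised by one so that the range contains `k = 0`, which carries the constant
  -- coefficient.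
  have hN' : ∀ k, N + 1 ≤ k → (toConv (augProj K A) ^ k) x = 0 := fun k hk => hN k (by omega)
  have hM' : ∀ k, M + 1 ≤ k → (toConv (augProj K A) ^ k) y = 0 := fun k hk => hM k (by omega)
  have h := HasLinearCoeff.sum (K := K) (Finset.range (N + 1) ×ˢ Finset.range (M + 1))
    fun i _ => HasLinearCoeff.eval_smul (binomialPoly K i.1 * binomialPoly K i.2)
      ((toConv (augProj K A) ^ i.1) x ⊗ₜ[K] (toConv (augProj K A) ^ i.2) y)
  convert h using 1
  · funext n
    rw [convPow_id_apply _ _ hN', convPow_id_apply _ _ hM', TensorProduct.sum_tmul,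
      Finset.sum_product]
    refine Finset.sum_congr rfl fun k _ => ?_
    rw [TensorProduct.tmul_sum]
    refine Finset.sum_congr rfl fun l _ => ?_
    rw [TensorProduct.smul_tmul_smul, Polynomial.eval_mul, binomialPoly_eval, binomialPoly_eval]
  · have hx : algebraMap K A (Coalgebra.counit x) = ∑ k ∈ Finset.range (N + 1),
        (binomialPoly K k).coeff 0 • (toConv (augProj K A) ^ k) x := by
      simp [binomialPoly_coeff_zero]
    have hy : algebraMap K A (Coalgebra.counit y) = ∑ k ∈ Finset.range (M + 1),
        (binomialPoly K k).coeff 0 • (toConv (augProj K A) ^ k) y := by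
      simp [binomialPoly_coeff_zero]
    rw [hx, hy, eulerian_apply hA hN', eulerian_apply hA hM', TensorProduct.sum_tmul,
      TensorProduct.sum_tmul, ← Finset.sum_add_distrib, Finset.sum_product]
    refine Finset.sum_congr rfl fun k _ => ?_
    rw [TensorProduct.tmul_sum, TensorProduct.tmul_sum, ← Finset.sum_add_distrib]
    refine Finset.sum_congr rfl fun l _ => ?_
    rw [TensorProduct.smul_tmul_smul, TensorProduct.smul_tmul_smul, ← add_smul,
      Polynomial.mul_coeff_one, add_comm]

/-- Both sides of `comul_convPow_id` are polynomial in `n`; their linear coefficients at `a` are `Δ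
(e a)` and `e a ⊗ 1 + 1 ⊗ e a`. -/
theorem eulerian_mem_primitives [CharZero K] [Coalgebra.IsCocomm K A] (a : A) :
    eulerian hA a ∈ primitives K A := by
  rw [mem_primitives]
  have h1 := (hasLinearCoeff_eulerian hA a).map (Coalgebra.comul (R := K))
  simp only [comul_convPow_id] at h1
  have h2 (t : A ⊗[K] A) : HasLinearCoeff K (fun n =>
      TensorProduct.map (toConv (LinearMap.id : A →ₗ[K] A) ^ n).ofConv
        (toConv (LinearMap.id : A →ₗ[K] A) ^ n).ofConv t)
      (TensorProduct.map (eulerian hA) (Algebra.linearMap K A) (Coalgebra.counit.lTensor A t) +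
        TensorProduct.map (Algebra.linearMap K A) (eulerian hA) (Coalgebra.counit.rTensor A t)) := by
    induction t with
    | zero => simpa using HasLinearCoeff.zero
    | tmul x y => exact hasLinearCoeff_tmul_convPow hA x y
    | add s t hs ht =>
      simp only [map_add]
      convert hs.add ht using 1
      abel
  have h3 := h1.unique (h2 _)
  rw [h3, Coalgebra.lTensor_counit_comul, Coalgebra.rTensor_counit_comul]
  simp

end Conilpotent

section Primitive

theorem counit_eq_zero_of_mem_primitives {x : A} (hx : x ∈ primitives K A) :
    Coalgebra.counit (R := K) x = 0 := by
  have h := Coalgebra.rTensor_counit_comul (R := K) x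
  rw [(mem_primitives K A).1 hx] at h
  have h2 := congrArg (Coalgebra.counit (R := K) ∘ TensorProduct.lid K A) h
  simpa using h2

theorem comul_pow_of_mem_primitives {x : A} (hx : x ∈ primitives K A) (m : ℕ) :
    Coalgebra.comul (R := K) (x ^ m) =
      ∑ j ∈ Finset.range (m + 1), (m.choose j : K) • (x ^ j) ⊗ₜ[K] (x ^ (m - j)) := by
  rw [Bialgebra.comul_pow, (mem_primitives K A).1 hx, Commute.add_pow]
  · refine Finset.sum_congr rfl fun j _ => ?_
    rw [← nsmul_eq_mul', Nat.cast_smul_eq_nsmul]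
    simp
  · simp [Commute, SemiconjBy]

theorem convPow_id_pow {x : A} (hx : x ∈ primitives K A) (n m : ℕ) :
    (toConv (LinearMap.id : A →ₗ[K] A) ^ n) (x ^ m) = (n : K) ^ m • x ^ m := by
  induction n generalizing m with
  | zero =>
    rw [pow_zero, LinearMap.convOne_apply, Bialgebra.counit_pow,
      counit_eq_zero_of_mem_primitives hx]
    cases m <;> simp
  | succ n ih =>
    rw [pow_succ, LinearMap.convMul_apply, comul_pow_of_mem_primitives hx, Nat.cast_succ, add_pow,
      Finset.sum_smul, map_sum, map_sum]
    refine Finset.sum_congr rfl fun j hj => ?_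
    have hj' : j + (m - j) = m := Nat.add_sub_of_le (Nat.lt_succ_iff.1 (Finset.mem_range.1 hj))
    simp [ih, ← pow_add, hj', smul_smul, mul_comm]

/-- The `n`th convolution power of `id` scales `x ^ m` by `n ^ m`, whose linear coefficient is
nonzero only for `m = 1`. -/
theorem eulerian_pow [CharZero K] (hA : ∀ a : A, ∃ n, a ∈ augmentationFiltration K (1 : A) n)
    {x : A} (hx : x ∈ primitives K A) (m : ℕ) :
    eulerian hA (x ^ m) = if m = 1 then x else 0 := by
  have h1 := hasLinearCoeff_eulerian hA (x ^ m)
  simp only [convPow_id_pow hx] at h1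
  have h2 := HasLinearCoeff.eval_smul (K := K) (Polynomial.X ^ m) (x ^ m)
  simp only [Polynomial.eval_pow, Polynomial.eval_X] at h2
  rw [h1.unique h2, Polynomial.coeff_X_pow]
  split_ifs with h h' h'
  · simp [← h]
  · exact absurd h.symm h'
  · exact absurd h'.symm h
  · simp

end Primitive

theorem adjoin_primitives_eq_top [CharZero K] [Coalgebra.IsCocomm K A]
    (hA : ∀ a : A, ∃ n, a ∈ augmentationFiltration K (1 : A) n) :
    Algebra.adjoin K (primitives K A : Set A) = ⊤ := by
  set S := Algebra.adjoin K (primitives K A : Set A)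
  have key (n : ℕ) : ∀ a ∈ augmentationFiltration K (1 : A) n, ∀ k,
      (toConv (augProj K A) ^ k) a ∈ S := by
    induction n with
    | zero =>
      intro a ha k
      obtain rfl : a = 0 := ha
      rw [map_zero]
      exact S.zero_mem
    | succ n ih =>
      intro a ha
      have h0 : (toConv (augProj K A) ^ 0) a ∈ S := S.algebraMap_mem _
      have h2 (k : ℕ) : (toConv (augProj K A) ^ (k + 2)) a ∈ S := by
        rw [pow_succ' _ (k + 1)]
        exact convMul_mem_of_mem_augmentationFiltration_succ ha _ _ augProj_one
          (convPow_succ_apply_one _ augProj_one k) S (fun b hb => by simpa using ih b hb 1)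
          fun b hb => ih b hb _
      have h1 : (toConv (augProj K A) ^ 1) a ∈ S := by
        have he : eulerian hA a ∈ S := Algebra.subset_adjoin (eulerian_mem_primitives hA a)
        have hN : ∀ k, n + 2 ≤ k → (toConv (augProj K A) ^ k) a = 0 := fun k hk =>
          convPow_eq_zero_of_mem_augmentationFiltration ha _ augProj_one (by omega)
        -- Split off `k = 0` and `k = 1`, whose coefficients are `0` and `1`; the rest lies in `S`
        -- by `h2`.
        rw [eulerian_apply hA hN, Finset.sum_range_succ', Finset.sum_range_succ', add_assoc,
          add_comm] at he
        have hs : ∑ k ∈ Finset.range n, (binomialPoly K (k + 1 + 1)).coeff 1 •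
            (toConv (augProj K A) ^ (k + 1 + 1)) a ∈ S :=
          S.sum_mem fun k _ => S.smul_mem (h2 k) _
        have h3 := S.sub_mem he hs
        rw [add_sub_cancel_right] at h3
        simpa [binomialPoly_zero, binomialPoly_one, Polynomial.coeff_one] using h3
      rintro (_ | _ | k)
      exacts [h0, h1, h2 k]
  rw [eq_top_iff]
  rintro a -
  obtain ⟨n, hn⟩ := hA a
  have h := S.add_mem (key n a hn 1) (S.algebraMap_mem (Coalgebra.counit (R := K) a))
  simpa [augProj] using h

end Eulerian

/-! ### Polarization: spanning by powers -/

section Powers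

variable {K B : Type*} [Field K] [Ring B] [Algebra K B]

/-- The coefficient of `t` in `(x + t y) ^ m`. -/
def linearPowCoeff (x y : B) (m : ℕ) : B :=
  ∑ j ∈ Finset.range m, x ^ j * y * x ^ (m - 1 - j)

theorem linearPowCoeff_succ (x y : B) (m : ℕ) :
    linearPowCoeff x y (m + 1) = linearPowCoeff x y m * x + x ^ m * y := by
  rw [linearPowCoeff, Finset.sum_range_succ, linearPowCoeff, Finset.sum_mul]
  congr 1
  · refine Finset.sum_congr rfl fun j hj => ?_
    have hj' := Finset.mem_range.1 hj
    rw [mul_assoc _ _ x, ← pow_succ]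
    congr 2
    omega
  · simp

theorem hasLinearCoeff_add_smul_pow (x y : B) (m : ℕ) :
    HasLinearCoeff K (fun n => (x + (n : K) • y) ^ m) (linearPowCoeff x y m) := by
  intro φ
  let P : Polynomial B := Polynomial.C x + Polynomial.C y * Polynomial.X
  have hP0 (m : ℕ) : (P ^ m).coeff 0 = x ^ m := by
    induction m with
    | zero => simp
    | succ m ih => rw [pow_succ, Polynomial.mul_coeff_zero, ih, pow_succ]; simp [P]
  have hP1 (m : ℕ) : (P ^ m).coeff 1 = linearPowCoeff x y m := by
    induction m with
    | zero => simp [linearPowCoeff, Polynomial.coeff_one]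
    | succ m ih =>
      rw [pow_succ, Polynomial.mul_coeff_one, ih, hP0, linearPowCoeff_succ, add_comm]
      simp [P]
  have hPe (n : ℕ) : (P ^ m).eval (n : B) = (x + (n : K) • y) ^ m := by
    -- Evaluation at `n` is multiplicative although `B` need not be commutative, because natural
    -- numbers are central.
    let ev : Polynomial B →+* B :=
      Polynomial.eval₂RingHom' (RingHom.id B) (n : B) fun a => Nat.commute_cast a n
    change ev (P ^ m) = _
    rw [map_pow]
    congr 1
    change P.eval (n : B) = _
    simp [P, Nat.cast_smul_eq_nsmul, Nat.cast_comm]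
  refine ⟨∑ i ∈ Finset.range ((P ^ m).natDegree + 2),
    Polynomial.C (φ ((P ^ m).coeff i)) * Polynomial.X ^ i, fun n => ?_, ?_⟩
  · beta_reduce
    rw [← hPe, Polynomial.eval_eq_sum_range' (n := (P ^ m).natDegree + 2) (by omega), map_sum,
      Polynomial.eval_finsetSum]
    refine Finset.sum_congr rfl fun i _ => ?_
    rw [← Nat.cast_pow, ← nsmul_eq_mul', map_nsmul, nsmul_eq_mul, Nat.cast_pow,
      Polynomial.eval_mul, Polynomial.eval_C, Polynomial.eval_pow, Polynomial.eval_X, mul_comm]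
  · rw [Polynomial.finsetSum_coeff, ← hP1, Finset.sum_eq_single 1]
    · simp
    · intro i _ hi
      rw [Polynomial.coeff_C_mul_X_pow, if_neg hi.symm]
    · intro h
      exact absurd (Finset.mem_range.2 (by omega)) h

variable (K) in
/-- The span of the powers `x ^ k`, `k ≤ m`, of the elements of a subspace. -/
def spanPow (L : Submodule K B) (m : ℕ) : Submodule K B :=
  Submodule.span K {b | ∃ x ∈ L, ∃ k ≤ m, b = x ^ k}

theorem spanPow_mono (L : Submodule K B) : Monotone (spanPow K L) :=
  fun _ _ h => Submodule.span_mono fun _ ⟨x, hx, k, hk, hb⟩ => ⟨x, hx, k, hk.trans h, hb⟩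

theorem pow_mem_spanPow {L : Submodule K B} {x : B} (hx : x ∈ L) (m : ℕ) : x ^ m ∈ spanPow K L m :=
  Submodule.subset_span ⟨x, hx, m, le_rfl, rfl⟩

variable {L : Submodule K B}

/-- The commutator has degree `j`, one less than either product, because `L` is closed under
brackets. -/
theorem pow_mul_sub_mul_pow_mem (hL : ∀ x ∈ L, ∀ y ∈ L, x * y - y * x ∈ L)
    {x y : B} (hx : x ∈ L) (hy : y ∈ L) (j : ℕ) :
    x ^ j * y - y * x ^ j ∈ (1 ⊔ L) ^ j := by
  have hle : L ≤ 1 ⊔ L := le_sup_right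
  induction j with
  | zero => simp
  | succ j ih =>
    have h1 : x ^ (j + 1) * y - y * x ^ (j + 1) =
        x * (x ^ j * y - y * x ^ j) + (x * y - y * x) * x ^ j := by
      rw [pow_succ']; noncomm_ring
    rw [h1, pow_succ']
    exact add_mem (Submodule.mul_mem_mul (hle hx) ih)
      (Submodule.mul_mem_mul (hle (hL x hx y hy)) (Submodule.pow_mem_pow _ (hle hx) j))

/-- Up to lower degree, `(k + 1) y x ^ k` is the coefficient of `t` in `(x + t y) ^ (k + 1)`, which
lies in the span of powers; then divide by `k + 1`. -/
theorem pow_le_spanPow [CharZero K] (hL : ∀ x ∈ L, ∀ y ∈ L, x * y - y * x ∈ L)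
    (m : ℕ) : (1 ⊔ L) ^ m ≤ spanPow K L m := by
  have hle : L ≤ 1 ⊔ L := le_sup_right
  have hmono {i j : ℕ} (h : i ≤ j) : (1 ⊔ L) ^ i ≤ (1 ⊔ L) ^ j :=
    pow_le_pow_right' le_sup_left h
  induction m with
  | zero =>
    rw [pow_zero, Submodule.one_le]
    simpa using pow_mem_spanPow (K := K) L.zero_mem 0
  | succ m ih =>
    have key : ∀ y ∈ L, ∀ b ∈ spanPow K L m, y * b ∈ spanPow K L (m + 1) := by
      intro y hy b hb
      induction hb using Submodule.span_induction with
      | zero => simp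
      | add a b _ _ ha hb => rw [mul_add]; exact add_mem ha hb
      | smul r b _ hb => rw [mul_smul_comm]; exact Submodule.smul_mem _ _ hb
      | mem b hb =>
        obtain ⟨x, hx, k, hk, rfl⟩ := hb
        have hc : linearPowCoeff x y (k + 1) ∈ spanPow K L (m + 1) :=
          (hasLinearCoeff_add_smul_pow (K := K) x y (k + 1)).mem _ fun n =>
            spanPow_mono L (Nat.succ_le_succ hk)
              (pow_mem_spanPow (L.add_mem hx (L.smul_mem _ hy)) (k + 1))
        have hd : linearPowCoeff x y (k + 1) - ((k + 1 : ℕ) : K) • (y * x ^ k) ∈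
            spanPow K L (m + 1) := by
          have h1 : linearPowCoeff x y (k + 1) - ((k + 1 : ℕ) : K) • (y * x ^ k) =
              ∑ j ∈ Finset.range (k + 1), (x ^ j * y - y * x ^ j) * x ^ (k - j) := by
            rw [Nat.cast_smul_eq_nsmul, ← Finset.card_range (k + 1), ← Finset.sum_const,
              linearPowCoeff, Finset.card_range, ← Finset.sum_sub_distrib]
            refine Finset.sum_congr rfl fun j hj => ?_
            have hj' := Finset.mem_range.1 hj
            rw [sub_mul, mul_assoc y, ← pow_add, Nat.add_sub_cancel,
              Nat.add_sub_of_le (by omega)]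
          rw [h1]
          refine Submodule.sum_mem _ fun j hj => spanPow_mono L m.le_succ (ih (hmono hk ?_))
          have hj' := Finset.mem_range.1 hj
          have h2 := Submodule.mul_mem_mul (pow_mul_sub_mul_pow_mem hL hx hy j)
            (Submodule.pow_mem_pow _ (hle hx) (k - j))
          rwa [← pow_add, Nat.add_sub_of_le (by omega)] at h2
        have hs := sub_mem hc hd
        rw [sub_sub_cancel] at hs
        exact (Submodule.smul_mem_iff _ (Nat.cast_ne_zero.2 k.succ_ne_zero)).1 hs
    rw [pow_succ', Submodule.mul_le]
    intro a ha b hb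
    obtain ⟨c, hc, y, hy, rfl⟩ := Submodule.mem_sup.1 ha
    obtain ⟨r, rfl⟩ := Submodule.mem_one.1 hc
    rw [add_mul, ← Algebra.smul_def]
    exact add_mem (Submodule.smul_mem _ _ (spanPow_mono L m.le_succ (ih hb))) (key y hy b (ih hb))

theorem span_pow_eq_top_of_adjoin_eq_top [CharZero K]
    (hL : ∀ x ∈ L, ∀ y ∈ L, x * y - y * x ∈ L)
    (h : Algebra.adjoin K (L : Set B) = ⊤) :
    Submodule.span K {b : B | ∃ x ∈ L, ∃ k, b = x ^ k} = ⊤ := by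
  have hmono {i j : ℕ} (h : i ≤ j) : (1 ⊔ L) ^ i ≤ (1 ⊔ L) ^ j :=
    pow_le_pow_right' le_sup_left h
  have key : ∀ b ∈ Algebra.adjoin K (L : Set B), ∃ m, b ∈ (1 ⊔ L) ^ m := by
    intro b hb
    induction hb using Algebra.adjoin_induction with
    | mem x hx => exact ⟨1, by rw [pow_one]; exact Submodule.mem_sup_right hx⟩
    | algebraMap r => exact ⟨0, by rw [pow_zero]; exact Submodule.algebraMap_mem r⟩
    | add x y _ _ hx hy =>
      obtain ⟨m, hm⟩ := hx
      obtain ⟨n, hn⟩ := hy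
      exact ⟨max m n, add_mem (hmono (le_max_left _ _) hm) (hmono (le_max_right _ _) hn)⟩
    | mul x y _ _ hx hy =>
      obtain ⟨m, hm⟩ := hx
      obtain ⟨n, hn⟩ := hy
      exact ⟨m + n, by rw [pow_add]; exact Submodule.mul_mem_mul hm hn⟩
  rw [eq_top_iff]
  rintro b -
  obtain ⟨m, hm⟩ := key b (h ▸ Algebra.mem_top)
  exact Submodule.span_mono (by rintro _ ⟨x, hx, k, -, rfl⟩; exact ⟨x, hx, k, rfl⟩)
    (pow_le_spanPow hL m hm)

end Powers

/-! ### Powers span the enveloping algebra -/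

namespace UniversalEnvelopingAlgebra

variable {K L : Type*} [Field K] [LieRing L] [LieAlgebra K L]

/-- By the universal property the identity factors through the subalgebra generated by the image of
`ι`. -/
theorem adjoin_range_ι :
    Algebra.adjoin K (Set.range (ι K : L → UniversalEnvelopingAlgebra K L)) = ⊤ := by
  set S := Algebra.adjoin K (Set.range (ι K : L → UniversalEnvelopingAlgebra K L))
  have hS (x : L) : ι K x ∈ S := Algebra.subset_adjoin ⟨x, rfl⟩
  let f : L →ₗ⁅K⁆ S :=
    { toFun x := ⟨ι K x, hS x⟩
      map_add' x y := Subtype.ext (map_add _ x y)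
      map_smul' r x := Subtype.ext (map_smul _ r x)
      map_lie' {x y} := Subtype.ext (LieHom.map_lie _ x y) }
  have hf : S.val.comp (lift K f) = AlgHom.id K _ := algHom_ext_ι fun x => by
    rw [AlgHom.comp_apply, lift_ι_apply]
    rfl
  rw [eq_top_iff]
  rintro b -
  rw [← AlgHom.id_apply (R := K) b, ← hf]
  exact (lift K f b).2

/-- In characteristic zero, the enveloping algebra is spanned by the powers of elements of the Lie
algebra. -/
theorem span_ι_pow_eq_top [CharZero K] :
    Submodule.span K {b : UniversalEnvelopingAlgebra K L | ∃ (x : L) (k : ℕ), b = ι K x ^ k} =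
      ⊤ := by
  have h := span_pow_eq_top_of_adjoin_eq_top
    (L := LinearMap.range (ι K : L →ₗ⁅K⁆ UniversalEnvelopingAlgebra K L).toLinearMap) ?_ ?_
  · rw [← h]
    congr 1
    ext b
    constructor
    · rintro ⟨x, k, rfl⟩
      exact ⟨_, ⟨x, rfl⟩, k, rfl⟩
    · rintro ⟨_, ⟨x, rfl⟩, k, rfl⟩
      exact ⟨x, k, rfl⟩
  · rintro _ ⟨x, rfl⟩ _ ⟨y, rfl⟩
    exact ⟨⁅x, y⁆, LieHom.map_lie _ x y⟩
  · exact adjoin_range_ι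

end UniversalEnvelopingAlgebra

/-! ### The comparison map and its bijectivity -/

section CartierMilnorMoore

open WithConv UniversalEnvelopingAlgebra

variable {K A : Type*} [Field K] [Ring A] [Bialgebra K A]

variable (K A) in
/-- The bialgebra map from the enveloping algebra of the primitive elements that extends the
inclusion. -/
noncomputable def envelopingToBialgebra :
    UniversalEnvelopingAlgebra K (primitives K A) →ₐc[K] A :=
  .ofAlgHom (lift K (primitives K A).incl)
    (algHom_ext_ι fun x => by
      change Coalgebra.counit (lift K (primitives K A).incl (ι K x)) =
        Coalgebra.counit (R := K) (ι K x)
      rw [lift_ι_apply, counit_ι]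
      exact counit_eq_zero_of_mem_primitives x.2)
    (algHom_ext_ι fun x => by
      change Algebra.TensorProduct.map _ _ (Coalgebra.comul (R := K) (ι K x)) =
        Coalgebra.comul (lift K (primitives K A).incl (ι K x))
      rw [comul_ι, map_add, Algebra.TensorProduct.map_tmul, Algebra.TensorProduct.map_tmul,
        lift_ι_apply, map_one]
      exact ((mem_primitives K A).1 x.2).symm)

theorem envelopingToBialgebra_ι (x : primitives K A) :
    envelopingToBialgebra K A (ι K x) = x :=
  lift_ι_apply K (primitives K A).incl x

theorem envelopingToBialgebra_surjective
    (h : Algebra.adjoin K (primitives K A : Set A) = ⊤) :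
    Function.Surjective (envelopingToBialgebra K A) := by
  have hle : Algebra.adjoin K (primitives K A : Set A) ≤
      (envelopingToBialgebra K A : UniversalEnvelopingAlgebra K (primitives K A) →ₐ[K] A).range :=
    Algebra.adjoin_le fun x hx => ⟨ι K ⟨x, hx⟩, envelopingToBialgebra_ι _⟩
  rw [h] at hle
  exact fun a => hle Algebra.mem_top

/-- In the binomial expansion of `Δ (x ^ m)` each factor `g` keeps only the term of degree one,
contributing successively `m`, `m - 1`, and so on. -/
theorem convPow_pow_of_mem_primitives {B : Type*} [Ring B] [Algebra K B] (g : A →ₗ[K] B) {x : A}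
    (hx : x ∈ primitives K A) (hg : ∀ m, m ≠ 1 → g (x ^ m) = 0) (n m : ℕ) :
    (toConv g ^ n) (x ^ m) = if n = m then (m.factorial : K) • g x ^ m else 0 := by
  induction n generalizing m with
  | zero =>
    rw [pow_zero, LinearMap.convOne_apply, Bialgebra.counit_pow,
      counit_eq_zero_of_mem_primitives hx]
    cases m <;> simp
  | succ n ih =>
    rw [pow_succ', LinearMap.convMul_apply, comul_pow_of_mem_primitives hx, map_sum, map_sum]
    cases m with
    | zero =>
      have h0 : g 1 = 0 := by simpa using hg 0 zero_ne_one
      simp [h0]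
    | succ m =>
      rw [Finset.sum_eq_single 1]
      · simp only [ih, map_smul, TensorProduct.map_tmul, pow_one, Nat.choose_one_right,
          LinearMap.mul'_apply, Nat.add_sub_cancel, Nat.add_right_cancel_iff]
        split_ifs
        · rw [mul_smul_comm, smul_smul, ← pow_succ', ← Nat.cast_mul, ← Nat.factorial_succ]
        · simp
      · intro j _ hj
        simp [hg j hj]
      · simp

theorem envelopingToBialgebra_injective [CharZero K] [Coalgebra.IsCocomm K A]
    (hA : ∀ a : A, ∃ n, a ∈ augmentationFiltration K (1 : A) n) :
    Function.Injective (envelopingToBialgebra K A) := by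
  let e : A →ₗ[K] primitives K A :=
    (eulerian hA).codRestrict (primitives K A).toSubmodule (eulerian_mem_primitives hA)
  have he (x : primitives K A) (m : ℕ) : e ((x : A) ^ m) = if m = 1 then x else 0 := by
    apply Subtype.ext
    refine (eulerian_pow hA x.2 m).trans ?_
    split_ifs <;> rfl
  let g : A →ₗ[K] UniversalEnvelopingAlgebra K (primitives K A) :=
    (ι K : primitives K A →ₗ⁅K⁆ _).toLinearMap ∘ₗ e
  have hg (x : primitives K A) (m : ℕ) : g ((x : A) ^ m) = if m = 1 then ι K x else 0 := by
    change ι K (e ((x : A) ^ m)) = _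
    rw [he]
    split_ifs
    · rfl
    · exact map_zero _
  have hg1 : g 1 = 0 := by simpa using hg 0 0
  -- The terms of the convolution exponential of `g`.
  let G (k : ℕ) : A →ₗ[K] UniversalEnvelopingAlgebra K (primitives K A) :=
    (k.factorial : K)⁻¹ • (toConv g ^ k).ofConv
  have hG (a : A) : ∃ N, ∀ k, N ≤ k → G k a = 0 :=
    (exists_convPow_eq_zero hA g hg1 a).imp fun N hN k hk => by
      rw [LinearMap.smul_apply, hN k hk, smul_zero]
  have hGx (x : primitives K A) (k m : ℕ) : G k ((x : A) ^ m) = if k = m then ι K x ^ m else 0 := by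
    rw [LinearMap.smul_apply, convPow_pow_of_mem_primitives g x.2 fun m hm => by simp [hg, hm]]
    have h1 := hg x 1
    rw [pow_one, if_pos rfl] at h1
    split_ifs with h
    · rw [h1, smul_smul, h, inv_mul_cancel₀ (Nat.cast_ne_zero.2 m.factorial_ne_zero), one_smul]
    · rw [smul_zero]
  let Ψ := locallyFiniteSum G hG
  have hΨ (b) : Ψ (envelopingToBialgebra K A b) = b := by
    have hb : b ∈ Submodule.span K {b : UniversalEnvelopingAlgebra K (primitives K A) |
        ∃ (x : primitives K A) (k : ℕ), b = ι K x ^ k} := by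
      rw [span_ι_pow_eq_top]
      trivial
    induction hb using Submodule.span_induction with
    | zero => rw [map_zero, map_zero]
    | add a b _ _ ha hb => rw [map_add, map_add, ha, hb]
    | smul r b _ hb => rw [map_smul, map_smul, hb]
    | mem b hb =>
      obtain ⟨x, m, rfl⟩ := hb
      rw [map_pow, envelopingToBialgebra_ι]
      refine (locallyFiniteSum_apply G hG (N := m + 1) fun k hk => ?_).trans ?_
      · rw [hGx, if_neg (by omega)]
      · simp [hGx, -ι_apply]
  exact Function.LeftInverse.injective hΨ

end CartierMilnorMoore

theorem mainTheorem9 (K A : Type*) [Field K] [CharZero K] [Ring A] [Bialgebra K A]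
    [Coalgebra.IsCocomm K A] (hA : IsConnectedCoalgebra K A) :
    Nonempty (A ≃ₐc[K] UniversalEnvelopingAlgebra K (primitives K A)) := by
  have h := hA.exists_mem_augmentationFiltration
  exact ⟨(BialgEquiv.ofBijective (envelopingToBialgebra K A)
    ⟨envelopingToBialgebra_injective h,
      envelopingToBialgebra_surjective (adjoin_primitives_eq_top h)⟩).symm⟩
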